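/- Let $S$ be a commutative semitopological semigroup, that is, a commutative semigroup with a Hausdorff topology for which the translations $x\mapsto sx$ and $x\mapsto xs$ are continuous for every $s\in S$, and suppose that $S$ is not compact. Let $\mathcal{CB}(S)$ be the C*-algebra of bounded continuous functions $S\to\mathbb C$. For $s\in S$ put $(L_sf)(x)=f(sx)$ and $(R_sf)(x)=f(xs)$. Let $Lmc(S)$ be the C*-algebra of all $f\in\mathcal{CB}(S)$ such that $s\mapsto\mu(L_sf)$ is continuous on $S$ for every multiplicative mean (nonzero multiplicative linear functional) $\mu$ on $\mathcal{CB}(S)$, and let $wap(S)$ be the C*-algebra of all $f\in\mathcal{CB}(S)$ for which $\{R_sf:s\in S\}$ is relatively compact in the weak topology of $\mathcal{CB}(S)$. Let $S^{Lmc}$ and $S^{wap}$ be the spectra (the spaces of multiplicative means, with the Gelfand topology) of $Lmc(S)$ and $wap(S)$. On $S^{Lmc}$ define $\mu*\nu=\mu\circ T_\nu$, where $(T_\nu f)(s)=\nu(L_sf)$ for $f\in Lmc(S)$ and $s\in S$, and let $\varepsilon:S\to S^{Lmc}$, $\varepsilon(s)(f)=f(s)$, be the evaluation map. Put $S^*=S^{Lmc}\setminus\varepsilon(S)$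 and $S^**S^*=\{\mu*\nu:\mu,\nu\in S^*\}$, and for $A\subseteq S$ let $\overline A$ be the closure of $\varepsilon(A)$ in $S^{Lmc}$. Let $A=f^{-1}(\{0\})$ for some $f\in Lmc(S)$, and suppose that $A$ is unbounded, i.e. $\overline A\cap S^*\neq\emptyset$, and that (i) $\operatorname{card}(\overline A)=\operatorname{card}(S^{Lmc})$, and (ii) $\overline A\cap cl_{S^{Lmc}}(S^**S^*)=\emptyset$. Then $\operatorname{card}(S^{wap})=\operatorname{card}(S^{Lmc})$. -/

import Mathlib

open scoped BoundedContinuousFunction Pointwise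

universe u

namespace SemigroupCompactification

open WeakDual

noncomputable section

section Translations

variable {S : Type u} [Semigroup S] [TopologicalSpace S] [SeparatelyContinuousMul S]

/-- The left translate `L_s f = f ∘ λ_s`, i.e. `x ↦ f (s * x)`, as a star algebra endomorphism of
the algebra `CB(S)` of bounded continuous complex-valued functions on `S`. -/
def leftTranslate (s : S) : (S →ᵇ ℂ) →⋆ₐ[ℂ] (S →ᵇ ℂ) where
  toFun f := f.compContinuous ⟨fun x => s * x, continuous_const_mul s⟩
  map_one' := rfl
  map_mul' _ _ := rfl
  map_zero' := rfl
  map_add' _ _ := rfl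
  commutes' _ := rfl
  map_star' _ := rfl

@[simp]
theorem leftTranslate_apply (s : S) (f : S →ᵇ ℂ) (x : S) : leftTranslate s f x = f (s * x) := rfl

/-- The right translate `R_t f = f ∘ r_t`, i.e. `x ↦ f (x * t)`. -/
def rightTranslate (t : S) : (S →ᵇ ℂ) →ₗ[ℂ] (S →ᵇ ℂ) where
  toFun f := f.compContinuous ⟨fun x => x * t, continuous_mul_const t⟩
  map_add' _ _ := rfl
  map_smul' _ _ := rfl

@[simp]
theorem rightTranslate_apply (t : S) (f : S →ᵇ ℂ) (x : S) : rightTranslate t f x = f (x * t) := rfl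

theorem leftTranslate_leftTranslate (s t : S) (f : S →ᵇ ℂ) :
    leftTranslate t (leftTranslate s f) = leftTranslate (s * t) f := by
  ext x
  simp [mul_assoc]

theorem norm_leftTranslate_le (s : S) (f : S →ᵇ ℂ) : ‖leftTranslate s f‖ ≤ ‖f‖ :=
  (BoundedContinuousFunction.norm_le (norm_nonneg f)).2 fun x => f.norm_coe_le_norm (s * x)

end Translations

variable (S : Type u) [Semigroup S] [TopologicalSpace S] [SeparatelyContinuousMul S]

/-- The C*-algebra `Lmc(S)` of left multiplicatively continuous functions: those `f ∈ CB(S)` for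
which `T_μ f : s ↦ μ (L_s f)` is continuous for every `μ` in the spectrum `βS` of `CB(S)`.
(`T_μ f` is automatically bounded, by `‖f‖`.) -/
def Lmc : StarSubalgebra ℂ (S →ᵇ ℂ) where
  carrier := {f | ∀ μ : characterSpace ℂ (S →ᵇ ℂ), Continuous fun s : S => μ (leftTranslate s f)}
  mul_mem' hf hg μ := by
    simpa only [map_mul] using! (hf μ).mul (hg μ)
  add_mem' hf hg μ := by
    simpa only [map_add] using! (hf μ).add (hg μ)
  algebraMap_mem' c μ := by
    simpa only [AlgHomClass.commutes] using continuous_const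
  star_mem' hf μ := by
    simpa only [map_star] using (hf μ).star

variable {S}

theorem mem_Lmc {f : S →ᵇ ℂ} : f ∈ Lmc S ↔
    ∀ μ : characterSpace ℂ (S →ᵇ ℂ), Continuous fun s : S => μ (leftTranslate s f) := Iff.rfl

variable (S)

theorem isClosed_Lmc : IsClosed (Lmc S : Set (S →ᵇ ℂ)) := by
  refine isClosed_of_closure_subset fun f hf μ => ?_
  refine continuous_of_uniform_approx_of_continuous fun u hu => ?_
  obtain ⟨ε, hε, hu⟩ := Metric.mem_uniformity_dist.1 hu
  obtain ⟨g, hg, hfg⟩ := Metric.mem_closure_iff.1 hf ε hε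
  refine ⟨_, hg μ, fun s => hu ?_⟩
  rw [dist_eq_norm, ← map_sub, ← map_sub]
  calc ‖μ (leftTranslate s (f - g))‖ ≤ ‖leftTranslate s (f - g)‖ :=
        NonUnitalStarAlgHom.norm_apply_le μ _
    _ ≤ ‖f - g‖ := norm_leftTranslate_le s _
    _ < ε := by rwa [← dist_eq_norm]

instance instIsClosedLmc : IsClosed (Lmc S : Set (S →ᵇ ℂ)) := isClosed_Lmc S

/-- The space `S^{Lmc}`: the spectrum of the commutative C*-algebra `Lmc(S)`, i.e. its set of
nonzero multiplicative functionals with the Gelfand (weak-*) topology. -/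
abbrev SLmc : Type u := characterSpace ℂ (Lmc S)

variable {S}

/-- Every element of `S^{Lmc}` is the restriction of a multiplicative functional on `CB(S)`. -/
theorem exists_extension (ν : SLmc S) :
    ∃ μ : characterSpace ℂ (S →ᵇ ℂ), ∀ f : Lmc S, ν f = μ (f : S →ᵇ ℂ) := by
  let r : C(characterSpace ℂ (S →ᵇ ℂ), SLmc S) :=
    CharacterSpace.compContinuousMap (Lmc S).subtype
  have hr : ∀ (μ : characterSpace ℂ (S →ᵇ ℂ)) (f : Lmc S), r μ f = μ (f : S →ᵇ ℂ) :=
    fun _ _ => rfl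
  by_cases hν : ν ∈ Set.range r
  · obtain ⟨μ, rfl⟩ := hν
    exact ⟨μ, hr μ⟩
  exfalso
  have hcl : IsClosed (Set.range r) := (isCompact_range r.continuous).isClosed
  obtain ⟨g, hg0, hg1, -⟩ := exists_continuous_zero_one_of_isClosed hcl
    (isClosed_singleton (x := ν)) (Set.disjoint_singleton_right.2 hν)
  let G : C(SLmc S, ℂ) := ⟨fun x => (g x : ℂ), by fun_prop⟩
  obtain ⟨f, hf⟩ := (gelfandTransform_bijective (Lmc S)).2 G
  have hfx : ∀ x : SLmc S, x f = (g x : ℂ) := fun x => DFunLike.congr_fun hf x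
  have hf0 : (f : S →ᵇ ℂ) = 0 := by
    apply (gelfandTransform_bijective (S →ᵇ ℂ)).1
    ext μ
    have h := hfx (r μ)
    rw [hr μ f, hg0 (Set.mem_range_self μ)] at h
    simpa using h
  have h1 := hfx ν
  rw [hg1 (Set.mem_singleton ν), show f = 0 from Subtype.ext hf0, map_zero] at h1
  simp at h1

/-- `Lmc(S)` is invariant under left translations. -/
theorem leftTranslate_mem_Lmc (s : S) {f : S →ᵇ ℂ} (hf : f ∈ Lmc S) : leftTranslate s f ∈ Lmc S := by
  intro μ
  simp only [leftTranslate_leftTranslate]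
  exact (hf μ).comp (continuous_const_mul s)

/-- The left translate of an element of `Lmc(S)`, as an element of `Lmc(S)`. -/
def leftTranslateLmc (s : S) (f : Lmc S) : Lmc S :=
  ⟨leftTranslate s f, leftTranslate_mem_Lmc s f.2⟩

theorem continuous_apply_leftTranslateLmc (ν : SLmc S) (f : Lmc S) :
    Continuous fun s : S => ν (leftTranslateLmc s f) := by
  obtain ⟨μ, hμ⟩ := exists_extension ν
  simp only [hμ]
  exact f.2 μ

/-- The function `T_ν f : s ↦ ν (L_s f)` as an element of `CB(S)`, for `f ∈ Lmc(S)` and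
`ν ∈ S^{Lmc}`. -/
def introvertFun (ν : SLmc S) (f : Lmc S) : S →ᵇ ℂ :=
  BoundedContinuousFunction.ofNormedAddCommGroup (fun s => ν (leftTranslateLmc s f))
    (continuous_apply_leftTranslateLmc ν f) ‖f‖ fun s =>
      (NonUnitalStarAlgHom.norm_apply_le ν (leftTranslateLmc s f)).trans
        (norm_leftTranslate_le s (f : S →ᵇ ℂ))

@[simp]
theorem introvertFun_apply (ν : SLmc S) (f : Lmc S) (s : S) :
    introvertFun ν f s = ν (leftTranslateLmc s f) := rfl

theorem leftTranslate_introvertFun (ν : SLmc S) (f : Lmc S) (s : S) :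
    leftTranslate s (introvertFun ν f) = introvertFun ν (leftTranslateLmc s f) := by
  ext t
  simp only [leftTranslate_apply, introvertFun_apply]
  congr 1
  exact Subtype.ext (leftTranslate_leftTranslate s t (f : S →ᵇ ℂ)).symm

/-- The map `f ↦ T_ν f` as an algebra homomorphism `Lmc(S) → CB(S)`. -/
def introvertAux (ν : SLmc S) : Lmc S →ₐ[ℂ] (S →ᵇ ℂ) where
  toFun := introvertFun ν
  map_one' := by ext s; exact map_one ν
  map_mul' f g := by
    ext s; exact map_mul ν (leftTranslateLmc s f) (leftTranslateLmc s g)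
  map_zero' := by ext s; exact map_zero ν
  map_add' f g := by
    ext s; exact map_add ν (leftTranslateLmc s f) (leftTranslateLmc s g)
  commutes' c := by
    ext s; exact AlgHomClass.commutes ν c

/-- `Lmc(S)` is m-admissible: `T_ν f` lies in `Lmc(S)` for `f ∈ Lmc(S)` and `ν ∈ S^{Lmc}`. -/
theorem introvertFun_mem_Lmc (ν : SLmc S) (f : Lmc S) : introvertFun ν f ∈ Lmc S := by
  intro μ
  simp only [leftTranslate_introvertFun]
  exact continuous_apply_leftTranslateLmc
    (CharacterSpace.equivAlgHom.symm ((CharacterSpace.toAlgHom μ).comp (introvertAux ν))) f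

/-- The operator `T_ν : Lmc(S) → Lmc(S)`, `(T_ν f)(s) = ν (L_s f)`. -/
def introvert (ν : SLmc S) : Lmc S →ₐ[ℂ] Lmc S :=
  (introvertAux ν).codRestrict (Lmc S).toSubalgebra (introvertFun_mem_Lmc ν)

/-- The multiplication of `S^{Lmc}`: `μ * ν = μ ∘ T_ν`. -/
instance instMulSLmc : Mul (SLmc S) where
  mul μ ν := CharacterSpace.equivAlgHom.symm ((CharacterSpace.toAlgHom μ).comp (introvert ν))

theorem mul_apply (μ ν : SLmc S) (f : Lmc S) : (μ * ν) f = μ (introvert ν f) := rfl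

theorem introvert_apply (ν : SLmc S) (f : Lmc S) (s : S) :
    (introvert ν f : S →ᵇ ℂ) s = ν (leftTranslateLmc s f) := rfl

/-- The evaluation map `ε : S → S^{Lmc}`, `ε(s)(f) = f(s)`. -/
def evalLmc (s : S) : SLmc S :=
  CharacterSpace.equivAlgHom.symm
    { toFun := fun f => (f : S →ᵇ ℂ) s
      map_one' := rfl
      map_mul' := fun _ _ => rfl
      map_zero' := rfl
      map_add' := fun _ _ => rfl
      commutes' := fun _ => rfl }

@[simp]
theorem evalLmc_apply (s : S) (f : Lmc S) : evalLmc s f = (f : S →ᵇ ℂ) s := rfl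

/-- The closure `Ā` in `S^{Lmc}` of (the image under `ε` of) a set `A ⊆ S`. -/
def closureLmc (A : Set S) : Set (SLmc S) := closure (evalLmc '' A)

variable (S)

/-- The remainder `S^* = S^{Lmc} - S`, where `S` is identified with its image under `ε`. -/
def remainder : Set (SLmc S) := (Set.range (evalLmc : S → SLmc S))ᶜ

/-- `Z(Lmc(S))`, the collection of the zero sets of the elements of `Lmc(S)`. -/
def zeroSetsLmc : Set (Set S) := {A | ∃ f ∈ Lmc S, A = f ⁻¹' {0}}

variable {S}

/-- `A ⊆ S` is unbounded if its closure in `S^{Lmc}` meets `S^*`. -/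
def IsUnboundedSet (A : Set S) : Prop := (closureLmc A ∩ remainder S).Nonempty

/-- `f ∈ CB(S)` is weakly almost periodic if the set `R_S f = {f ∘ r_t : t ∈ S}` of its right
translates is relatively compact in the weak topology of the Banach space `CB(S)`. -/
def IsWeaklyAlmostPeriodic (f : S →ᵇ ℂ) : Prop :=
  IsCompact (closure (toWeakSpace ℂ (S →ᵇ ℂ) '' Set.range fun t : S => rightTranslate t f))

variable (S)

/-- The space `wap(S)` of weakly almost periodic functions on `S`. -/
def wap : Submodule ℂ (S →ᵇ ℂ) where
  carrier := {f | IsWeaklyAlmostPeriodic f}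
  zero_mem' := by
    have : IsCompact ({0} : Set (WeakSpace ℂ (S →ᵇ ℂ))) := isCompact_singleton
    refine this.closure_of_subset ?_
    rintro _ ⟨_, ⟨t, rfl⟩, rfl⟩
    simp
  add_mem' {f g} hf hg := by
    refine (IsCompact.add hf hg).closure_of_subset ?_
    rintro _ ⟨_, ⟨t, rfl⟩, rfl⟩
    simp only [map_add]
    exact Set.add_mem_add (subset_closure ⟨_, ⟨t, rfl⟩, rfl⟩) (subset_closure ⟨_, ⟨t, rfl⟩, rfl⟩)
  smul_mem' c f hf := by
    refine (IsCompact.smul c hf).closure_of_subset ?_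
    rintro _ ⟨_, ⟨t, rfl⟩, rfl⟩
    simp only [map_smul]
    exact Set.smul_mem_smul_set (subset_closure ⟨_, ⟨t, rfl⟩, rfl⟩)

variable {S}

theorem one_mem_wap : (1 : S →ᵇ ℂ) ∈ wap S := by
  have : IsCompact ({toWeakSpace ℂ (S →ᵇ ℂ) 1} : Set (WeakSpace ℂ (S →ᵇ ℂ))) :=
    isCompact_singleton
  refine this.closure_of_subset ?_
  rintro _ ⟨_, ⟨t, rfl⟩, rfl⟩
  rfl

/-- A continuous linear functional `μ` on `wap(S)` is a mean if `μ(1) = 1` and `|μ(f)| ≤ ‖f‖` for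
all `f` (i.e. `μ(1) = ‖μ‖ = 1`); it is multiplicative if `μ(fg) = μ(f)μ(g)` for `f, g ∈ wap(S)`.
The last condition is written with the product as a third element `h` of `wap(S)`, so that the
definition does not presuppose that `wap(S)` is an algebra. -/
structure IsMultiplicativeMean (μ : WeakDual ℂ (wap S)) : Prop where
  map_one : μ ⟨1, one_mem_wap⟩ = 1
  norm_le : ∀ f : wap S, ‖μ f‖ ≤ ‖f‖
  map_mul : ∀ f g h : wap S, (h : S →ᵇ ℂ) = (f : S →ᵇ ℂ) * (g : S →ᵇ ℂ) → μ h = μ f * μ g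

variable (S)

/-- The space `S^{wap}`: the spectrum of `wap(S)`, i.e. its set of multiplicative means (with the
topology of pointwise convergence on `wap(S)`). -/
abbrev SWap : Type u := {μ : WeakDual ℂ (wap S) // IsMultiplicativeMean μ}

end

end SemigroupCompactification

/-! ### Grothendieck's theorem: pointwise versus weak topology on `C(K, ℂ)`. -/

section PointwiseToWeak

open Filter Topology MeasureTheory

/-! Since `wap S` lies in `Lmc S`, characters restrict to a map `SLmc S → SWap S`. It is onto,
giving one inequality (`restrictWap_surjective`). It is injective off the closure of `S^* * S^*`
(`restrictWap_injOn`), hence on `Ā` by (ii), and (i) gives the other.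

For injectivity, Urysohn and Gelfand duality give `f` in `Lmc S` vanishing on `S^* * S^*` and
separating two given points. Points of `ε(S)` are central because `S` is commutative, so `μ * ν` and
`ν * μ` always agree at `f`. Hence `ν ↦ T_ν f` is a family with compact index space, containing the
right translates of `f` and continuous against every character of `CB(S)`. Grothendieck's theorem
upgrades this to weak continuity, so `f` is in `wap S`. -/

/-- Finitely many continuous functions on a compact space admit a finite net of points. -/
theorem ContinuousMap.exists_finset_forall_dist_lt {K X : Type*} [TopologicalSpace K]
    [CompactSpace K] (Φ : X → C(K, ℂ)) (F : Finset X) {ε : ℝ}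
    (hε : 0 < ε) : ∃ D : Finset K, ∀ k, ∃ d ∈ D, ∀ x ∈ F, dist (Φ x k) (Φ x d) < ε := by
  have hopen : ∀ d : K, IsOpen {k | ∀ x ∈ F, dist (Φ x k) (Φ x d) < ε} := fun d => by
    simp only [Set.ofPred_forall]
    exact isOpen_biInter_finset fun x _ =>
      isOpen_lt ((Φ x).continuous.dist continuous_const) continuous_const
  obtain ⟨D, hD⟩ := isCompact_univ.elim_finite_subcover _ hopen
    fun k _ => Set.mem_iUnion.2 ⟨k, fun x _ => by simpa using hε⟩
  refine ⟨D, fun k => ?_⟩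
  simpa using hD (Set.mem_univ k)

variable {K : Type*} [TopologicalSpace K] [CompactSpace K] [T2Space K]

/-- A bounded sequence of continuous functions tending pointwise to zero has convex combinations
that are uniformly small. -/
theorem ContinuousMap.exists_mem_convexHull_lt (u : ℕ → C(K, ℝ)) {C : ℝ}
    (hC : ∀ n x, ‖u n x‖ ≤ C) (hu : ∀ x, Tendsto (fun n => u n x) atTop (𝓝 0)) {ε : ℝ}
    (hε : 0 < ε) : ∃ g ∈ convexHull ℝ (Set.range u), ∀ x, g x < ε := by
  by_contra! hcon
  have hopen : IsOpen {g : C(K, ℝ) | ∀ x, g x < ε} := by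
    have := ContinuousMap.isOpen_setOfPred_mapsTo (X := K) (Y := ℝ) isCompact_univ (isOpen_Iio (a := ε))
    simpa [Set.MapsTo] using this
  have hconv : Convex ℝ {g : C(K, ℝ) | ∀ x, g x < ε} := by
    intro f hf g hg a b ha hb hab x
    exact (convex_Iio ε) (hf x) (hg x) ha hb hab
  have hdisj : Disjoint {g : C(K, ℝ) | ∀ x, g x < ε} (convexHull ℝ (Set.range u)) := by
    refine Set.disjoint_left.2 fun g hg hg' => ?_
    obtain ⟨x, hx⟩ := hcon g hg'
    exact absurd (hg x) hx.not_gt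
  obtain ⟨ψ, a, hψ, ha⟩ := geometric_hahn_banach_open hconv hopen (convex_convexHull ℝ _) hdisj
  have ha0 : 0 < a := by simpa using hψ 0 (fun x => by simpa using hε)
  -- If `ψ p < 0` with `p ≥ 0`, the nonpositive function `(a / ψ p) • p` lies in the open set, where
  -- `ψ < a`, yet `ψ` takes the value `a` there. Positivity makes `ψ` integration against a measure,
  -- and dominated convergence applies.
  have hpos : ∀ p : C(K, ℝ), (∀ x, 0 ≤ p x) → 0 ≤ ψ p := by
    intro p hp
    by_contra! hneg
    have h := hψ ((a / ψ p) • p) (fun x => by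
      refine lt_of_le_of_lt ?_ hε
      exact mul_nonpos_of_nonpos_of_nonneg (div_nonpos_of_nonneg_of_nonpos ha0.le hneg.le) (hp x))
    rw [map_smul, smul_eq_mul, div_mul_cancel₀ _ hneg.ne] at h
    exact lt_irrefl _ h
  let _ : MeasurableSpace K := borel K
  have _ : BorelSpace K := ⟨rfl⟩
  let Λ : CompactlySupportedContinuousMap K ℝ →ₚ[ℝ] ℝ := PositiveLinearMap.mk₀
    { toFun := fun f => ψ f.toContinuousMap
      map_add' := fun f g => ψ.map_add f.toContinuousMap g.toContinuousMap
      map_smul' := fun c f => ψ.map_smul c f.toContinuousMap } (fun f hf => hpos _ hf)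
  let m := RealRMK.rieszMeasure Λ
  have hm : ∀ f : C(K, ℝ), ∫ x, f x ∂m = ψ f := fun f =>
    RealRMK.integral_rieszMeasure Λ (CompactlySupportedContinuousMap.continuousMapEquiv f)
  have hlim : Tendsto (fun n => ∫ x, u n x ∂m) atTop (𝓝 (∫ _, (0 : ℝ) ∂m)) :=
    tendsto_integral_of_dominated_convergence (fun _ => C)
      (fun n => (u n).continuous.aestronglyMeasurable) (integrable_const C)
      (fun n => ae_of_all _ (hC n)) (ae_of_all _ hu)
  simp only [hm, integral_zero] at hlim
  exact absurd (ge_of_tendsto' hlim fun n => ha _ (subset_convexHull ℝ _ ⟨n, rfl⟩)) ha0.not_ge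

/-- Bounded pointwise convergence to zero implies weak convergence to zero, in the sense that no
continuous functional stays away from zero along the sequence. -/
theorem ContinuousMap.exists_norm_apply_lt_of_tendsto_zero (φ : C(K, ℂ) →L[ℂ] ℂ)
    (h : ℕ → C(K, ℂ)) {C : ℝ} (hC : ∀ n x, ‖h n x‖ ≤ C)
    (hh : ∀ x, Tendsto (fun n => h n x) atTop (𝓝 0)) {δ : ℝ} (hδ : 0 < δ) :
    ∃ n, ‖φ (h n)‖ < δ := by
  by_contra! hcon
  let u : ℕ → C(K, ℝ) := fun n => ⟨fun x => ‖h n x‖, by fun_prop⟩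
  obtain ⟨g, hg, hgε⟩ := exists_mem_convexHull_lt u (C := C) (fun n x => by simpa [u] using hC n x)
    (fun x => by simpa [u] using (hh x).norm) (ε := δ / (‖φ‖ + 1)) (by positivity)
  -- Rotating each `h n` by a phase makes `φ (h n)` real and at least `δ`; both that bound and
  -- domination by `g` survive convex combinations.
  have key : convexHull ℝ (Set.range u) ⊆
      {g : C(K, ℝ) | ∃ f : C(K, ℂ), δ ≤ (φ f).re ∧ ∀ x, ‖f x‖ ≤ g x} := by
    refine convexHull_min ?_ ?_
    · rintro _ ⟨n, rfl⟩
      have hz : ‖φ (h n)‖ ≠ 0 := (hδ.trans_le (hcon n)).ne'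
      refine ⟨((starRingEnd ℂ) (φ (h n)) / ‖φ (h n)‖) • h n, ?_, fun x => ?_⟩
      · have : (starRingEnd ℂ) (φ (h n)) / ‖φ (h n)‖ * φ (h n) = (‖φ (h n)‖ : ℂ) := by
          rw [div_mul_eq_mul_div, Complex.conj_mul', pow_two, mul_div_assoc,
            div_self (by exact_mod_cast hz), mul_one]
        rw [map_smul, smul_eq_mul, this, Complex.ofReal_re]
        exact hcon n
      · simp [u, hz]
    · rintro g₁ ⟨f₁, h₁, h₁'⟩ g₂ ⟨f₂, h₂, h₂'⟩ a b ha hb hab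
      refine ⟨(a : ℂ) • f₁ + (b : ℂ) • f₂, ?_, fun x => ?_⟩
      · simp only [map_add, map_smul, smul_eq_mul, Complex.add_re, Complex.re_ofReal_mul]
        calc δ = a * δ + b * δ := by rw [← add_mul, hab, one_mul]
          _ ≤ _ := by gcongr
      · calc ‖(a : ℂ) * f₁ x + (b : ℂ) * f₂ x‖ ≤ ‖(a : ℂ) * f₁ x‖ + ‖(b : ℂ) * f₂ x‖ :=
              norm_add_le _ _
          _ = a * ‖f₁ x‖ + b * ‖f₂ x‖ := by
              simp [abs_of_nonneg ha, abs_of_nonneg hb]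
          _ ≤ a * g₁ x + b * g₂ x := by gcongr <;> solve_by_elim
  obtain ⟨f, hf, hfg⟩ := key hg
  have hfn : ‖f‖ ≤ δ / (‖φ‖ + 1) :=
    (ContinuousMap.norm_le _ (by positivity)).2 fun x => (hfg x).trans (hgε x).le
  have : δ ≤ ‖φ‖ * (δ / (‖φ‖ + 1)) :=
    calc δ ≤ ‖φ f‖ := hf.trans (Complex.re_le_norm _)
      _ ≤ ‖φ‖ * ‖f‖ := φ.le_opNorm f
      _ ≤ _ := by gcongr
  rw [mul_div_assoc', le_div_iff₀ (by positivity)] at this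
  linarith

variable {X : Type*} [TopologicalSpace X]

omit [T2Space K] in
/-- In a pointwise compact family of continuous functions, every frequent property near `x₀` holds
along a sequence that converges pointwise to the member of index `x₀`. -/
theorem ContinuousMap.exists_seq_tendsto_apply_of_frequently [CompactSpace X] (Φ : X → C(K, ℂ))
    (hΦ : ∀ k, Continuous fun x => Φ x k) {x₀ : X} {P : X → Prop} (hP : ∃ᶠ x in 𝓝 x₀, P x) :
    ∃ x : ℕ → X, (∀ n, P (x n)) ∧ ∀ k, Tendsto (fun n => Φ (x n) k) atTop (𝓝 (Φ x₀ k)) := by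
  classical
  have hstep : ∀ (n : ℕ) (q : Finset X × Finset K), ∃ y, P y ∧
      ∀ d ∈ q.2, dist (Φ y d) (Φ x₀ d) < 1 / ((n : ℝ) + 1) := by
    intro n q
    have : ∀ᶠ y in 𝓝 x₀, ∀ d ∈ q.2, dist (Φ y d) (Φ x₀ d) < 1 / ((n : ℝ) + 1) := by
      rw [Filter.eventually_all_finset]
      exact fun d _ => (hΦ d).continuousAt.eventually
        (Metric.ball_mem_nhds _ Nat.one_div_pos_of_nat)
    exact (hP.and_eventually this).exists
  have hnet : ∀ (n : ℕ) (F : Finset X), ∃ D : Finset K, ∀ k, ∃ d ∈ D, ∀ x ∈ F,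
      dist (Φ x k) (Φ x d) < 1 / ((n : ℝ) + 1) := fun n F =>
    exists_finset_forall_dist_lt Φ F Nat.one_div_pos_of_nat
  choose y hyP hy using hstep
  choose net hnet using hnet
  -- Indices and test points chosen so far. Each new index is close to `x₀` on the old test points;
  -- a net for all indices so far is then added to the test points.
  let q : ℕ → Finset X × Finset K := fun n => Nat.rec ({x₀}, ∅)
    (fun n p => (insert (y n p) p.1, p.2 ∪ net n (insert (y n p) p.1))) n
  have hq₁ : ∀ n, (q (n + 1)).1 = insert (y n (q n)) (q n).1 := fun _ => rfl
  have hq₂ : ∀ n, (q (n + 1)).2 = (q n).2 ∪ net n (q (n + 1)).1 := fun _ => rfl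
  have hmono₁ : Monotone fun n => (q n).1 := monotone_nat_of_le_succ fun n => by
    simp only [hq₁]; exact Finset.subset_insert _ _
  have hmono₂ : Monotone fun n => (q n).2 := monotone_nat_of_le_succ fun n => by
    simp only [hq₂]; exact Finset.subset_union_left
  have hmem : ∀ {m n}, m ≤ n → y m (q m) ∈ (q (n + 1)).1 := fun {m n} hmn =>
    hmono₁ (Nat.succ_le_succ hmn) (by simp only [hq₁]; exact Finset.mem_insert_self _ _)
  have hmem₀ : ∀ n, x₀ ∈ (q n).1 := fun n => hmono₁ (Nat.zero_le n) (Finset.mem_singleton_self x₀)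
  have hone : Tendsto (fun n : ℕ => 1 / ((n : ℝ) + 1)) atTop (𝓝 0) :=
    tendsto_one_div_add_atTop_nhds_zero_nat
  have hD : ∀ m, ∀ d ∈ (q m).2, Tendsto (fun n => Φ (y n (q n)) d) atTop (𝓝 (Φ x₀ d)) := by
    intro m d hd
    rw [tendsto_iff_dist_tendsto_zero]
    refine squeeze_zero' (Eventually.of_forall fun _ => dist_nonneg) ?_ hone
    filter_upwards [eventually_ge_atTop m] with n hn
    exact (hy n (q n) d (hmono₂ hn hd)).le
  refine ⟨fun n => y n (q n), fun n => hyP _ _, fun k => ?_⟩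
  choose d hd hdk using fun n => hnet n (q (n + 1)).1 k
  have hdq : ∀ n, d n ∈ (q (n + 1)).2 := fun n => by
    rw [hq₂]; exact Finset.mem_union_right _ (hd n)
  -- The net points `d n` imitate `k` ever better on the chosen indices, so their cluster point `e`
  -- is indistinguishable from `k` by `x₀` and by every index of the sequence.
  obtain ⟨e, he⟩ := exists_clusterPt_of_compactSpace (map d atTop)
  obtain ⟨V, hV, hVe⟩ := mapClusterPt_iff_ultrafilter.1 he
  have hVeq : ∀ z : X, (∃ m, ∀ n ≥ m, z ∈ (q (n + 1)).1) → Φ z e = Φ z k := by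
    rintro z ⟨m, hm⟩
    refine tendsto_nhds_unique (((Φ z).continuous.tendsto e).comp hVe) ?_
    rw [tendsto_iff_dist_tendsto_zero]
    refine squeeze_zero' (Eventually.of_forall fun _ => dist_nonneg) ?_ (hone.mono_left hV)
    filter_upwards [hV (eventually_ge_atTop m)] with n hn
    rw [dist_comm]
    exact (hdk n z (hm n hn)).le
  -- For `z` a limit of the sequence along `U`, the limit `Φ z k` equals `Φ z e`, then `Φ x₀ e` (as
  -- `z` and `x₀` agree on all `d n`), then `Φ x₀ k`.
  refine tendsto_iff_ultrafilter _ _ _ |>.2 fun U hU => ?_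
  obtain ⟨z, -, hz⟩ := isCompact_univ.ultrafilter_le_nhds (U.map fun n => y n (q n)) (by simp)
  have hz' : ∀ j : K, Tendsto (fun n => Φ (y n (q n)) j) U (𝓝 (Φ z j)) := fun j =>
    ((hΦ j).tendsto z).comp hz
  have hzd : ∀ n, Φ z (d n) = Φ x₀ (d n) := fun n =>
    tendsto_nhds_unique (hz' (d n)) ((hD (n + 1) _ (hdq n)).mono_left hU)
  have hze : Φ z e = Φ x₀ e := by
    refine tendsto_nhds_unique (((Φ z).continuous.tendsto e).comp hVe) ?_
    simpa only [Function.comp_def, hzd] using ((Φ x₀).continuous.tendsto e).comp hVe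
  have hzk : Φ z k = Φ z e := by
    refine tendsto_nhds_unique (hz' k) ?_
    simpa only [hVeq _ ⟨_, fun n hn => hmem hn⟩] using hz' e
  have := hz' k
  rwa [hzk, hze, hVeq x₀ ⟨0, fun n _ => hmem₀ (n + 1)⟩] at this

/-- **Grothendieck's theorem**: a bounded, pointwise continuous family of continuous functions on a
compact space, indexed by a compact space, is weakly continuous. -/
theorem ContinuousMap.continuous_clm_apply_of_pointwise [CompactSpace X] (φ : C(K, ℂ) →L[ℂ] ℂ)
    (Φ : X → C(K, ℂ)) (hΦ : ∀ k, Continuous fun x => Φ x k) {C : ℝ} (hC : ∀ x k, ‖Φ x k‖ ≤ C) :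
    Continuous fun x => φ (Φ x) := by
  refine continuous_iff_continuousAt.2 fun x₀ => Metric.tendsto_nhds.2 fun ε hε => ?_
  by_contra hcon
  obtain ⟨x, hx, hlim⟩ := exists_seq_tendsto_apply_of_frequently Φ hΦ (not_eventually.1 hcon)
  obtain ⟨n, hn⟩ := exists_norm_apply_lt_of_tendsto_zero φ (fun n => Φ (x n) - Φ x₀) (C := C + C)
    (fun n k => (norm_sub_le _ _).trans (add_le_add (hC _ _) (hC _ _)))
    (fun k => by simpa using (hlim k).sub_const (Φ x₀ k)) hε
  exact hx n (by rwa [dist_eq_norm, ← map_sub])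

end PointwiseToWeak

namespace SemigroupCompactification

open WeakDual Topology

/-! ### Weak continuity in `CB(S)` tested on characters. -/

section WeakCompactness

variable {S : Type u} [TopologicalSpace S] {X : Type*} [TopologicalSpace X] [CompactSpace X]

theorem norm_character_apply_le (χ : characterSpace ℂ (S →ᵇ ℂ)) (f : S →ᵇ ℂ) : ‖χ f‖ ≤ ‖f‖ :=
  NonUnitalStarAlgHom.norm_apply_le χ f

/-- A bounded family in `CB(S)` that is continuous against the characters is weakly continuous. -/
theorem continuous_toWeakSpace_of_character (Φ : X → (S →ᵇ ℂ)) {C : ℝ} (hC : ∀ x, ‖Φ x‖ ≤ C)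
    (hΦ : ∀ χ : characterSpace ℂ (S →ᵇ ℂ), Continuous fun x => χ (Φ x)) :
    Continuous fun x => toWeakSpace ℂ (S →ᵇ ℂ) (Φ x) := by
  refine WeakBilin.continuous_of_continuous_eval _ fun φ => ?_
  -- Through the Gelfand transform, characters become the points of a compact space, where
  -- Grothendieck's theorem applies.
  let e := gelfandStarTransform (S →ᵇ ℂ)
  let φ' : C(characterSpace ℂ (S →ᵇ ℂ), ℂ) →L[ℂ] ℂ :=
    LinearMap.mkContinuous
      (φ.toLinearMap ∘ₗ (e.symm : C(characterSpace ℂ (S →ᵇ ℂ), ℂ) →⋆ₐ[ℂ] (S →ᵇ ℂ)).toLinearMap)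
      ‖φ‖ fun f => (φ.le_opNorm (e.symm f)).trans (by
        gcongr
        exact NonUnitalStarAlgHom.norm_apply_le e.symm f)
  have h := ContinuousMap.continuous_clm_apply_of_pointwise φ' (fun x => e (Φ x)) hΦ
    (fun x χ => (norm_character_apply_le χ _).trans (hC x))
  have h' : ∀ x, φ' (e (Φ x)) = φ (Φ x) := fun x => congrArg φ (e.symm_apply_apply (Φ x))
  simp only [h'] at h
  exact h

theorem continuous_clm_toWeakSpace_symm (φ : (S →ᵇ ℂ) →L[ℂ] ℂ) :
    Continuous fun a : WeakSpace ℂ (S →ᵇ ℂ) => φ ((toWeakSpace ℂ (S →ᵇ ℂ)).symm a) :=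
  WeakBilin.eval_continuous (topDualPairing ℂ (S →ᵇ ℂ)).flip φ

theorem continuous_character_toWeakSpace_symm (χ : characterSpace ℂ (S →ᵇ ℂ)) :
    Continuous fun a : WeakSpace ℂ (S →ᵇ ℂ) => χ ((toWeakSpace ℂ (S →ᵇ ℂ)).symm a) :=
  continuous_clm_toWeakSpace_symm (CharacterSpace.toCLM χ)

end WeakCompactness

/-! ### Algebraic closure properties of `wap(S)`. -/

section Wap

variable {S : Type u} [Semigroup S] [TopologicalSpace S] [SeparatelyContinuousMul S]

/-- `f` is weakly almost periodic if its right translates belong to a bounded family with compact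
index space that is continuous against the characters. -/
theorem isWeaklyAlmostPeriodic_of_family {X : Type*} [TopologicalSpace X] [CompactSpace X]
    {f : S →ᵇ ℂ} (Φ : X → (S →ᵇ ℂ)) {C : ℝ} (hC : ∀ x, ‖Φ x‖ ≤ C)
    (hΦ : ∀ χ : characterSpace ℂ (S →ᵇ ℂ), Continuous fun x => χ (Φ x))
    (hf : ∀ t, ∃ x, Φ x = rightTranslate t f) : IsWeaklyAlmostPeriodic f := by
  refine (isCompact_range (continuous_toWeakSpace_of_character Φ hC hΦ)).closure_of_subset ?_
  rintro _ ⟨_, ⟨t, rfl⟩, rfl⟩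
  obtain ⟨x, hx⟩ := hf t
  exact ⟨x, congrArg (toWeakSpace ℂ (S →ᵇ ℂ)) hx⟩

/-- The weak closure of the set of right translates of `f`. -/
abbrev weakHull (f : S →ᵇ ℂ) : Set (WeakSpace ℂ (S →ᵇ ℂ)) :=
  closure (toWeakSpace ℂ (S →ᵇ ℂ) '' Set.range fun t : S => rightTranslate t f)

theorem toWeakSpace_rightTranslate_mem_weakHull (t : S) (f : S →ᵇ ℂ) :
    toWeakSpace ℂ (S →ᵇ ℂ) (rightTranslate t f) ∈ weakHull f :=
  subset_closure ⟨_, ⟨t, rfl⟩, rfl⟩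

theorem norm_le_of_mem_weakHull {f : S →ᵇ ℂ} {a : WeakSpace ℂ (S →ᵇ ℂ)} (ha : a ∈ weakHull f) :
    ‖(toWeakSpace ℂ (S →ᵇ ℂ)).symm a‖ ≤ ‖f‖ := by
  refine (BoundedContinuousFunction.norm_le (norm_nonneg f)).2 fun s => ?_
  have hcl : IsClosed {a : WeakSpace ℂ (S →ᵇ ℂ) |
      ‖(toWeakSpace ℂ (S →ᵇ ℂ)).symm a s‖ ≤ ‖f‖} :=
    isClosed_le (continuous_clm_toWeakSpace_symm
      (BoundedContinuousFunction.evalCLM ℂ s)).norm continuous_const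
  refine closure_minimal ?_ hcl ha
  rintro _ ⟨_, ⟨t, rfl⟩, rfl⟩
  exact f.norm_coe_le_norm (s * t)

/-- Products from the two weak hulls are indexed by a compact space, and multiplicativity of
characters gives joint continuity against each of them. -/
theorem mul_mem_wap {f g : S →ᵇ ℂ} (hf : f ∈ wap S) (hg : g ∈ wap S) : f * g ∈ wap S := by
  have : CompactSpace (weakHull f) := isCompact_iff_compactSpace.1 hf
  have : CompactSpace (weakHull g) := isCompact_iff_compactSpace.1 hg
  refine isWeaklyAlmostPeriodic_of_family (X := weakHull f × weakHull g) (C := ‖f‖ * ‖g‖)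
    (fun p => (toWeakSpace ℂ (S →ᵇ ℂ)).symm p.1 * (toWeakSpace ℂ (S →ᵇ ℂ)).symm p.2)
    (fun p => (norm_mul_le _ _).trans (mul_le_mul (norm_le_of_mem_weakHull p.1.2)
      (norm_le_of_mem_weakHull p.2.2) (norm_nonneg _) (norm_nonneg _))) (fun χ => ?_)
    fun t => ⟨(⟨_, toWeakSpace_rightTranslate_mem_weakHull t f⟩,
      ⟨_, toWeakSpace_rightTranslate_mem_weakHull t g⟩), rfl⟩
  simp only [map_mul]
  exact ((continuous_character_toWeakSpace_symm χ).comp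
    (continuous_subtype_val.comp continuous_fst)).mul
    ((continuous_character_toWeakSpace_symm χ).comp (continuous_subtype_val.comp continuous_snd))

theorem star_mem_wap {f : S →ᵇ ℂ} (hf : f ∈ wap S) : star f ∈ wap S := by
  have : CompactSpace (weakHull f) := isCompact_iff_compactSpace.1 hf
  refine isWeaklyAlmostPeriodic_of_family (X := weakHull f) (C := ‖f‖)
    (fun p => star ((toWeakSpace ℂ (S →ᵇ ℂ)).symm p))
    (fun p => by rw [norm_star]; exact norm_le_of_mem_weakHull p.2) (fun χ => ?_)
    fun t => ⟨⟨_, toWeakSpace_rightTranslate_mem_weakHull t f⟩, rfl⟩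
  simp only [map_star]
  exact ((continuous_character_toWeakSpace_symm χ).comp continuous_subtype_val).star

end Wap

/-! ### Comparison of `wap(S)` and `Lmc(S)` for commutative `S`. -/

section Comm

variable {S : Type u} [CommSemigroup S] [TopologicalSpace S] [SeparatelyContinuousMul S]

/-- On the weakly compact hull the weak and pointwise topologies coincide, so the pointwise
continuous map `t ↦ R_t f` is weakly continuous; commutativity gives `L_t = R_t`. -/
theorem wap_le_Lmc {f : S →ᵇ ℂ} (hf : f ∈ wap S) : f ∈ Lmc S := by
  intro χ
  have hc : IsCompact (weakHull f) := hf
  let ev : WeakSpace ℂ (S →ᵇ ℂ) → S → ℂ := fun a => (toWeakSpace ℂ (S →ᵇ ℂ)).symm a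
  have hev : Continuous ev := continuous_pi fun s =>
    continuous_clm_toWeakSpace_symm (BoundedContinuousFunction.evalCLM ℂ s)
  have : CompactSpace (weakHull f) := isCompact_iff_compactSpace.1 hc
  have hinj : Function.Injective fun a : weakHull f => ev a := fun a b hab =>
    Subtype.ext ((toWeakSpace ℂ (S →ᵇ ℂ)).symm.injective (DFunLike.coe_injective hab))
  have hemb : IsEmbedding fun a : weakHull f => ev a :=
    ((hev.comp continuous_subtype_val).isClosedEmbedding hinj).isEmbedding
  let R : S → weakHull f := fun t => ⟨_, toWeakSpace_rightTranslate_mem_weakHull t f⟩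
  have hR : Continuous R := by
    refine hemb.continuous_iff.2 (continuous_pi fun s => ?_)
    exact f.continuous.comp (continuous_const_mul s)
  have h := (continuous_character_toWeakSpace_symm χ).comp (continuous_subtype_val.comp hR)
  convert h using 2 with s
  refine congrArg χ ?_
  ext x
  exact congrArg f (mul_comm s x)

theorem mul_evalLmc_comm_apply (s : S) (ν : SLmc S) (f : Lmc S) :
    (ν * evalLmc s) f = (evalLmc s * ν) f := by
  rw [mul_apply, mul_apply, evalLmc_apply, introvert_apply]
  refine congrArg ν (Subtype.ext ?_)
  ext t
  rw [introvert_apply, evalLmc_apply]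
  exact congrArg (f : S →ᵇ ℂ) (mul_comm t s)

/-- A function in `Lmc(S)` on which the product of `S^{Lmc}` commutes is weakly almost periodic. -/
theorem mem_wap_of_mul_comm_apply (f : Lmc S)
    (hf : ∀ μ ν : SLmc S, (μ * ν) f = (ν * μ) f) : (f : S →ᵇ ℂ) ∈ wap S := by
  refine isWeaklyAlmostPeriodic_of_family (X := SLmc S) (C := ‖f‖) (fun ν => introvertFun ν f)
    (fun ν => ?_) (fun χ => ?_) fun t => ⟨evalLmc t, ?_⟩
  · exact (BoundedContinuousFunction.norm_le (norm_nonneg f)).2 fun s =>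
      (NonUnitalStarAlgHom.norm_apply_le ν (leftTranslateLmc s f)).trans
        (norm_leftTranslate_le s (f : S →ᵇ ℂ))
  · let μ : SLmc S := CharacterSpace.compContinuousMap (Lmc S).subtype χ
    have h : ∀ ν, χ (introvertFun ν f) = ν (introvert μ f) := fun ν => hf μ ν
    simp only [h]
    exact (gelfandTransform ℂ (Lmc S) (introvert μ f)).continuous
  · ext s
    rfl

/-- A function in `Lmc(S)` that vanishes on `S^* * S^*` is weakly almost periodic. -/
theorem mem_wap_of_vanishing (f : Lmc S)
    (hf : ∀ μ ∈ remainder S * remainder S, μ f = 0) : (f : S →ᵇ ℂ) ∈ wap S := by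
  refine mem_wap_of_mul_comm_apply f fun μ ν => ?_
  by_cases hμ : μ ∈ remainder S
  · by_cases hν : ν ∈ remainder S
    · rw [hf _ (Set.mul_mem_mul hμ hν), hf _ (Set.mul_mem_mul hν hμ)]
    · obtain ⟨s, rfl⟩ := not_not.1 hν
      exact mul_evalLmc_comm_apply s μ f
  · obtain ⟨s, rfl⟩ := not_not.1 hμ
    exact (mul_evalLmc_comm_apply s ν f).symm

/-! ### The restriction map between the spectra. -/

/-- The inclusion of `wap(S)` into `Lmc(S)`. -/
noncomputable def wapInclusion : wap S →L[ℂ] Lmc S :=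
  LinearMap.mkContinuous
    { toFun := fun f => ⟨f, wap_le_Lmc f.2⟩
      map_add' := fun _ _ => rfl
      map_smul' := fun _ _ => rfl } 1 fun f => (one_mul ‖f‖).ge

/-- The restriction map from `S^{Lmc}` to `S^{wap}`. -/
noncomputable def restrictWap (ν : SLmc S) : SWap S :=
  ⟨StrongDual.toWeakDual ((CharacterSpace.toCLM ν).comp wapInclusion),
    { map_one := map_one ν
      norm_le := fun f => NonUnitalStarAlgHom.norm_apply_le ν (wapInclusion f)
      map_mul := fun f g h hh => by
        have : wapInclusion h = wapInclusion f * wapInclusion g := Subtype.ext hh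
        change ν (wapInclusion h) = ν (wapInclusion f) * ν (wapInclusion g)
        rw [this, map_mul] }⟩

/-- A member of `wap(S)` annihilated by a multiplicative mean has a zero on `S^{Lmc}`. -/
theorem exists_character_eq_zero {m : WeakDual ℂ (wap S)} (hm : IsMultiplicativeMean m)
    {f : wap S} (hf : m f = 0) : ∃ ν : SLmc S, ν (wapInclusion f) = 0 := by
  by_contra! hne
  have hS : Nonempty S := by
    by_contra hempty
    rw [not_nonempty_iff] at hempty
    have : (⟨1, one_mem_wap⟩ : wap S) = 0 := Subtype.ext (by ext s; exact hempty.elim s)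
    have h1 := hm.map_one
    rw [this, map_zero] at h1
    exact zero_ne_one h1
  have hK : Nonempty (SLmc S) := hS.map evalLmc
  let g : wap S := ⟨star (f : S →ᵇ ℂ) * f, mul_mem_wap (star_mem_wap f.2) f.2⟩
  have hmg : m g = 0 := by
    rw [hm.map_mul ⟨star (f : S →ᵇ ℂ), star_mem_wap f.2⟩ f g rfl, hf, mul_zero]
  obtain ⟨ν₀, -, hν₀⟩ := isCompact_univ.exists_isMinOn Set.univ_nonempty
    (gelfandTransform ℂ (Lmc S) (wapInclusion f)).continuous.norm.continuousOn
  have hmin : ∀ s : S, ‖ν₀ (wapInclusion f)‖ ≤ ‖(f : S →ᵇ ℂ) s‖ := fun s =>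
    hν₀ (Set.mem_univ (evalLmc s))
  have hδ : 0 < ‖ν₀ (wapInclusion f)‖ := norm_pos_iff.2 (hne ν₀)
  -- Here `h = ‖f‖² - |f|²`. If `|f|` is bounded away from zero, `‖h‖ < ‖f‖²`, whereas `m h = ‖f‖²`
  -- and `m` is contractive. No inverse of `f` in `wap S` is needed.
  let h : wap S := ((‖f‖ ^ 2 : ℝ) : ℂ) • ⟨1, one_mem_wap⟩ - g
  have hmh : m h = ((‖f‖ ^ 2 : ℝ) : ℂ) := by
    rw [map_sub, map_smul, hmg, hm.map_one, smul_eq_mul, mul_one, sub_zero]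
  have hbound : ‖h‖ ≤ ‖f‖ ^ 2 - ‖ν₀ (wapInclusion f)‖ ^ 2 := by
    refine (BoundedContinuousFunction.norm_le_of_nonempty (f := (h : S →ᵇ ℂ))).2 fun s => ?_
    have hs : (h : S →ᵇ ℂ) s = ((‖f‖ ^ 2 - ‖(f : S →ᵇ ℂ) s‖ ^ 2 : ℝ) : ℂ) := by
      have : (h : S →ᵇ ℂ) s = ((‖f‖ ^ 2 : ℝ) : ℂ) * 1 -
        (starRingEnd ℂ) ((f : S →ᵇ ℂ) s) * (f : S →ᵇ ℂ) s := rfl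
      rw [this, Complex.conj_mul']
      push_cast
      ring
    have hle : ‖(f : S →ᵇ ℂ) s‖ ≤ ‖f‖ := (f : S →ᵇ ℂ).norm_coe_le_norm s
    have hle' := pow_le_pow_left₀ (norm_nonneg _) hle 2
    rw [hs, Complex.norm_real, Real.norm_of_nonneg (by linarith)]
    linarith [pow_le_pow_left₀ hδ.le (hmin s) 2]
  have hn := hm.norm_le h
  rw [hmh, Complex.norm_real, Real.norm_of_nonneg (by positivity)] at hn
  linarith [pow_pos hδ 2]

/-- The zero sets of members of `ker m` are nonempty and compact, and directed because `|f₁|² +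
|f₂|²` stays in `ker m`. A common zero `ν` kills every `f - m(f)1`, so it restricts to `m`. -/
theorem restrictWap_surjective : Function.Surjective (restrictWap : SLmc S → SWap S) := by
  rintro ⟨m, hm⟩
  let Z : {f : wap S // m f = 0} → Set (SLmc S) := fun f => {ν | ν (wapInclusion f.1) = 0}
  have hZ : ∀ f, IsClosed (Z f) := fun f =>
    isClosed_eq (gelfandTransform ℂ (Lmc S) (wapInclusion f.1)).continuous continuous_const
  have hdir : Directed (· ⊇ ·) Z := by
    rintro ⟨f₁, h₁⟩ ⟨f₂, h₂⟩
    let g₁ : wap S := ⟨star (f₁ : S →ᵇ ℂ) * f₁, mul_mem_wap (star_mem_wap f₁.2) f₁.2⟩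
    let g₂ : wap S := ⟨star (f₂ : S →ᵇ ℂ) * f₂, mul_mem_wap (star_mem_wap f₂.2) f₂.2⟩
    have hg : m (g₁ + g₂) = 0 := by
      rw [map_add, hm.map_mul ⟨star (f₁ : S →ᵇ ℂ), star_mem_wap f₁.2⟩ f₁ g₁ rfl,
        hm.map_mul ⟨star (f₂ : S →ᵇ ℂ), star_mem_wap f₂.2⟩ f₂ g₂ rfl, h₁, h₂, mul_zero, mul_zero,
        add_zero]
    have key : ∀ ν ∈ Z ⟨g₁ + g₂, hg⟩,
        ν (wapInclusion f₁) = 0 ∧ ν (wapInclusion f₂) = 0 := by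
      intro ν hν
      have hν' : ν (star (wapInclusion f₁) * wapInclusion f₁ +
        star (wapInclusion f₂) * wapInclusion f₂) = 0 := hν
      rw [map_add, map_mul, map_mul, map_star, map_star, Complex.star_def,
        Complex.conj_mul', Complex.conj_mul'] at hν'
      have hr : ‖ν (wapInclusion f₁)‖ ^ 2 + ‖ν (wapInclusion f₂)‖ ^ 2 = 0 := by
        exact_mod_cast hν'
      rw [add_eq_zero_iff_of_nonneg (by positivity) (by positivity)] at hr
      simpa using hr
    exact ⟨⟨g₁ + g₂, hg⟩, fun ν hν => (key ν hν).1, fun ν hν => (key ν hν).2⟩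
  have : Nonempty {f : wap S // m f = 0} := ⟨⟨0, map_zero m⟩⟩
  obtain ⟨ν, hν⟩ := IsCompact.nonempty_iInter_of_directed_nonempty_isCompact_isClosed Z hdir
    (fun f => exists_character_eq_zero hm f.2) (fun f => (hZ f).isCompact) hZ
  refine ⟨ν, Subtype.ext (DFunLike.ext _ _ fun f => ?_)⟩
  have hf : m (f - m f • ⟨1, one_mem_wap⟩) = 0 := by
    rw [map_sub, map_smul, hm.map_one, smul_eq_mul, mul_one, sub_self]
  have hνf : ν (wapInclusion (f - m f • ⟨1, one_mem_wap⟩)) = 0 := Set.mem_iInter.1 hν ⟨_, hf⟩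
  have hone : wapInclusion (⟨1, one_mem_wap⟩ : wap S) = 1 := rfl
  rw [map_sub, map_smul, hone, map_sub, map_smul, map_one, smul_eq_mul, mul_one,
    sub_eq_zero] at hνf
  exact hνf

/-- Restriction to `wap(S)` is injective off the closure of `S^* * S^*`. -/
theorem restrictWap_injOn :
    Set.InjOn (restrictWap : SLmc S → SWap S) (closure (remainder S * remainder S))ᶜ := by
  intro p _ q hq hpq
  by_contra hne
  obtain ⟨g, hg0, hg1, -⟩ := exists_continuous_zero_one_of_isClosed
    ((isClosed_closure (s := remainder S * remainder S)).union (isClosed_singleton (x := p)))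
    (isClosed_singleton (x := q)) (Set.disjoint_singleton_right.2 (by
      rintro (h | h)
      · exact hq h
      · exact hne h.symm))
  let G : C(SLmc S, ℂ) := ⟨fun x => (g x : ℂ), by fun_prop⟩
  obtain ⟨f, hf⟩ := (gelfandTransform_bijective (Lmc S)).2 G
  have hfx : ∀ x : SLmc S, x f = (g x : ℂ) := fun x => DFunLike.congr_fun hf x
  have hwap : (f : S →ᵇ ℂ) ∈ wap S := mem_wap_of_vanishing f fun μ hμ => by
    rw [hfx, hg0 (Or.inl (subset_closure hμ))]
    simp
  have h : p f = q f := DFunLike.congr_fun (congrArg Subtype.val hpq) (⟨f, hwap⟩ : wap S)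
  rw [hfx, hfx, hg0 (Or.inr rfl), hg1 rfl] at h
  simp at h

end Comm

end SemigroupCompactification

theorem theorem3p17 {S : Type u} [CommSemigroup S] [TopologicalSpace S] [T2Space S]
    [SeparatelyContinuousMul S] [NoncompactSpace S]
    (A : Set S) (hA : A ∈ SemigroupCompactification.zeroSetsLmc S)
    (hunb : SemigroupCompactification.IsUnboundedSet A)
    (hcard : Cardinal.mk (SemigroupCompactification.closureLmc A) =
      Cardinal.mk (SemigroupCompactification.SLmc S))
    (hdisj : SemigroupCompactification.closureLmc A ∩
      closure (SemigroupCompactification.remainder S * SemigroupCompactification.remainder S) = ∅) :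
    Cardinal.mk (SemigroupCompactification.SWap S) =
      Cardinal.mk (SemigroupCompactification.SLmc S) := by
  refine le_antisymm (Cardinal.mk_le_of_surjective
    SemigroupCompactification.restrictWap_surjective) ?_
  rw [← hcard]
  exact Cardinal.mk_le_of_injective (Set.injOn_iff_injective.1
    (SemigroupCompactification.restrictWap_injOn.mono
      (Set.disjoint_iff_inter_eq_empty.2 hdisj).subset_compl_right))
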